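/- For a real $m\times n$ matrix $X$ with singular values $\sigma_1\ge\sigma_2\ge\dots\ge\sigma_{\min\{m,n\}}\ge 0$ and for $0<p<\infty$, let $\|X\|_{S_p}=\big(\sum_{j=1}^{\min\{m,n\}}\sigma_j^p\big)^{1/p}$, and for $v\in\mathbb{R}^L$ let $\|v\|_q=\big(\sum_{i=1}^L|v_i|^q\big)^{1/q}$. A linear map $\mathcal{A}:\mathbb{R}^{m\times n}\to\mathbb{R}^L$ is said to satisfy RIP-$\ell_2/\ell_q$ of order $k$ with constants $\delta^{\mathrm{lb}}_k,\delta^{\mathrm{sub}}_k$ if $$(1-\delta^{\mathrm{lb}}_k)\,\|X\|_{S_2}^q\;\le\;\frac1L\|\mathcal{A}(X)\|_q^q\;\le\;(1+\delta^{\mathrm{sub}}_k)\,\|X\|_{S_2}^q$$ for all nonzero $X\in\mathbb{R}^{m\times n}$ of rank at most $k$. Let $r$ be a positive integer, let $0<p\le q\le 1$, let $\tau>1$, and put $s=\big\lceil r\,\tau^{\frac{2p}{(2-p)q}}\big\rceil$. Suppose that a linear map $\mathcal{A}:\mathbb{R}^{m\times n}\to\mathbb{R}^L$ satisfies RIP-$\ell_2/\ell_q$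 of order $s+r$ with constants $\delta^{\mathrm{lb}}_{s+r},\delta^{\mathrm{sub}}_{s+r}$ such that $$\delta^{\mathrm{sub}}_{s+r}+\tau\,\delta^{\mathrm{lb}}_{s+r}<\tau-1 .$$ Then noiseless Schatten-$p$ minimization recovers all matrices of rank at most $r$ exactly: for every $X\in\mathbb{R}^{m\times n}$ with $\operatorname{rank}X\le r$ and $b=\mathcal{A}(X)$, the problem $$\min_{Z\in\mathbb{R}^{m\times n}}\ \|Z\|_{S_p}^p\quad\text{subject to}\quad \mathcal{A}(Z)=b$$ has $X$ as its one and only solution. -/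

import Mathlib

noncomputable section

/-- The `j`-th largest singular value of a real `m × n` matrix, with `j` counted from `0`: that of
the linear map `v ↦ X v` between Euclidean spaces. -/
def matrixSingularValue {m n : ℕ} (X : Matrix (Fin m) (Fin n) ℝ) (j : ℕ) : ℝ :=
  (Matrix.toEuclideanLin X).singularValues j

/-- The Schatten `p`-norm `(∑ σ_j ^ p) ^ (1 / p)` for `0 < p < ∞`, the sum running over the
`min m n` singular values of `X`. -/
def schattenNorm {m n : ℕ} (p : ℝ) (X : Matrix (Fin m) (Fin n) ℝ) : ℝ :=
  (∑ j ∈ Finset.range (min m n), matrixSingularValue X j ^ p) ^ (1 / p)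

/-- The `ℓ_q`-norm `(∑ |v_i| ^ q) ^ (1 / q)` of a real vector, for `0 < q < ∞`. -/
def vecLqNorm {L : ℕ} (q : ℝ) (v : Fin L → ℝ) : ℝ :=
  (∑ i, |v i| ^ q) ^ (1 / q)

/-- `ℓ_q`-restricted uniform boundedness of order `k` with constants `C₁` and `C₂`. -/
def IsLqRUB {m n L : ℕ} (A : Matrix (Fin m) (Fin n) ℝ →ₗ[ℝ] (Fin L → ℝ)) (q : ℝ) (k : ℕ)
    (C₁ C₂ : ℝ) : Prop :=
  ∀ X : Matrix (Fin m) (Fin n) ℝ, X ≠ 0 → X.rank ≤ k →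
    C₁ * schattenNorm 2 X ^ q ≤ vecLqNorm q (A X) ^ q / L ∧
      vecLqNorm q (A X) ^ q / L ≤ C₂ * schattenNorm 2 X ^ q

/-- The restricted isometry property RIP-`ℓ₂/ℓ_q` of order `k` with constants `δlb` and `δsub`. -/
def IsRIPL2Lq {m n L : ℕ} (A : Matrix (Fin m) (Fin n) ℝ →ₗ[ℝ] (Fin L → ℝ)) (q : ℝ) (k : ℕ)
    (δlb δsub : ℝ) : Prop :=
  IsLqRUB A q k (1 - δlb) (1 + δsub)

/-- `Z` solves the Schatten-`p` minimization problem: minimize `‖Z‖_{S_p} ^ p` subject to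
`b - A Z ∈ B`. -/
def IsSchattenMinimizer {m n L : ℕ} (A : Matrix (Fin m) (Fin n) ℝ →ₗ[ℝ] (Fin L → ℝ)) (p : ℝ)
    (b : Fin L → ℝ) (B : Set (Fin L → ℝ)) (Z : Matrix (Fin m) (Fin n) ℝ) : Prop :=
  b - A Z ∈ B ∧
    ∀ W : Matrix (Fin m) (Fin n) ℝ, b - A W ∈ B → schattenNorm p Z ^ p ≤ schattenNorm p W ^ p

end

/-! Let `Z` be feasible with Schatten norm at most that of `X`, and put `H = Z - X`, a matrix in the
kernel of `A`. Two facts force `H = 0`.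

Spectral fact: for concave increasing `f` with `f 0 = 0`, the sum of `|f (σ_k A) - f (σ_k B)|` is at
most the sum of `f (σ_k (A - B))`. Taken at `X` and `-H` with `f t = t ^ p`, it shows that the
`p`-th powers of the singular values of `H` beyond the first `r` sum to no more than the first `r`
do. For its proof, `A - B` is split along its right singular vectors into rank-one pieces. One such
piece makes singular values interlace, and Weyl monotonicity for self-adjoint dilations bounds their
total displacement by the norm of the piece. The displacement intervals do not overlap, so concavity
bounds the total increment of `f` by `f` of their total length.

Block argument: the singular value decomposition of `H` is cut into a head of `r + s` terms and
blocks of `s` terms. As `A H = 0` and the `q`-th power of the `ℓ_q`-norm is subadditive, the lower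
bound on the head and the upper bounds on the blocks can be compared. Each block is dominated in
`ℓ₂` by the preceding one in `ℓ_p`, and the choice of `s` makes the blocks together at most `1 / τ`
of the head. A nonzero `H` would then give `τ * (1 - δlb) ≤ 1 + δsub`, against the hypothesis. -/

open Module InnerProductSpace

/-! ### Courant–Fischer bounds for eigenvalues -/

section CourantFischer

variable {V : Type*} [NormedAddCommGroup V] [InnerProductSpace ℝ V]

theorem Submodule.exists_mem_ne_zero_of_finrank_lt [FiniteDimensional ℝ V]
    {W W' : Submodule ℝ V}
    (h : finrank ℝ V < finrank ℝ W + finrank ℝ W') : ∃ w, w ∈ W ∧ w ∈ W' ∧ w ≠ 0 := by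
  have h1 := Submodule.finrank_sup_add_finrank_inf_eq W W'
  have h2 := Submodule.finrank_le (W ⊔ W')
  have h3 : W ⊓ W' ≠ ⊥ := by
    intro h0
    rw [h0, finrank_bot] at h1
    omega
  obtain ⟨w, hw, hw0⟩ := Submodule.exists_mem_ne_zero_of_ne_bot h3
  exact ⟨w, hw.1, hw.2, hw0⟩

theorem OrthonormalBasis.finrank_span_image {n : ℕ} (b : OrthonormalBasis (Fin n) ℝ V)
    (S : Finset (Fin n)) : finrank ℝ (Submodule.span ℝ (b '' S)) = S.card := by
  have h := finrank_span_eq_card (R := ℝ) (b := fun i : S => b i)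
    (b.orthonormal.linearIndependent.comp _ Subtype.val_injective)
  have h2 : Set.range (fun i : S => b i) = b '' S := by
    ext; simp
  rw [h2] at h
  simpa using h

theorem OrthonormalBasis.inner_eq_zero_of_mem_span_image {n : ℕ}
    (b : OrthonormalBasis (Fin n) ℝ V) {S : Finset (Fin n)} {w : V}
    (hw : w ∈ Submodule.span ℝ (b '' S)) {i : Fin n} (hi : i ∉ S) : ⟪b i, w⟫_ℝ = 0 := by
  induction hw using Submodule.span_induction with
  | mem x hx =>
    obtain ⟨j, hj, rfl⟩ := hx
    exact b.orthonormal.2 (fun h => hi (h ▸ hj))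
  | zero => simp
  | add x y _ _ hx hy => rw [inner_add_right, hx, hy, add_zero]
  | smul a x _ hx => rw [inner_smul_right, hx, mul_zero]

theorem OrthonormalBasis.norm_sq_eq_sum {n : ℕ} (b : OrthonormalBasis (Fin n) ℝ V) (w : V) :
    ‖w‖ ^ 2 = ∑ i, ⟪b i, w⟫_ℝ ^ 2 := by
  rw [← b.sum_sq_norm_inner_right]
  simp

variable [FiniteDimensional ℝ V] {n : ℕ} {T : V →ₗ[ℝ] V}

theorem LinearMap.IsSymmetric.inner_apply_self_eq_sum (hT : T.IsSymmetric)
    (hn : finrank ℝ V = n) (w : V) :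
    ⟪T w, w⟫_ℝ = ∑ i, hT.eigenvalues hn i * ⟪hT.eigenvectorBasis hn i, w⟫_ℝ ^ 2 := by
  rw [← (hT.eigenvectorBasis hn).sum_inner_mul_inner]
  refine Finset.sum_congr rfl fun i _ => ?_
  rw [hT w, hT.apply_eigenvectorBasis, inner_smul_right, real_inner_comm]
  simp only [RCLike.ofReal_real_eq_id, id_eq]
  ring

/-- The span of the eigenvectors with indices `0, …, k` serves as `W`. -/
theorem LinearMap.IsSymmetric.exists_le_inner (hT : T.IsSymmetric) (hn : finrank ℝ V = n)
    (k : Fin n) : ∃ W : Submodule ℝ V, finrank ℝ W = k + 1 ∧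
      ∀ w ∈ W, hT.eigenvalues hn k * ‖w‖ ^ 2 ≤ ⟪T w, w⟫_ℝ := by
  refine ⟨Submodule.span ℝ (hT.eigenvectorBasis hn '' (Finset.Iic k : Finset (Fin n))), ?_, ?_⟩
  · rw [OrthonormalBasis.finrank_span_image, Fin.card_Iic]
  · intro w hw
    rw [hT.inner_apply_self_eq_sum hn, (hT.eigenvectorBasis hn).norm_sq_eq_sum, Finset.mul_sum]
    refine Finset.sum_le_sum fun i _ => ?_
    by_cases hi : i ∈ Finset.Iic k
    · exact mul_le_mul_of_nonneg_right
        (hT.eigenvalues_antitone hn (Finset.mem_Iic.1 hi)) (sq_nonneg _)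
    · rw [OrthonormalBasis.inner_eq_zero_of_mem_span_image _ hw hi]
      simp

theorem LinearMap.IsSymmetric.exists_inner_le (hT : T.IsSymmetric) (hn : finrank ℝ V = n)
    (k : Fin n) : ∃ W : Submodule ℝ V, finrank ℝ W = n - k ∧
      ∀ w ∈ W, ⟪T w, w⟫_ℝ ≤ hT.eigenvalues hn k * ‖w‖ ^ 2 := by
  refine ⟨Submodule.span ℝ (hT.eigenvectorBasis hn '' (Finset.Ici k : Finset (Fin n))), ?_, ?_⟩
  · rw [OrthonormalBasis.finrank_span_image, Fin.card_Ici]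
  · intro w hw
    rw [hT.inner_apply_self_eq_sum hn, (hT.eigenvectorBasis hn).norm_sq_eq_sum, Finset.mul_sum]
    refine Finset.sum_le_sum fun i _ => ?_
    by_cases hi : i ∈ Finset.Ici k
    · exact mul_le_mul_of_nonneg_right
        (hT.eigenvalues_antitone hn (Finset.mem_Ici.1 hi)) (sq_nonneg _)
    · rw [OrthonormalBasis.inner_eq_zero_of_mem_span_image _ hw hi]
      simp

/-- A lower bound for the quadratic form of `T` on a subspace of dimension `k + 1` bounds the
`k`-th largest eigenvalue from below. -/
theorem LinearMap.IsSymmetric.le_eigenvalues (hT : T.IsSymmetric) (hn : finrank ℝ V = n)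
    (k : Fin n) (W : Submodule ℝ V) (hW : k + 1 ≤ finrank ℝ W) (c : ℝ)
    (h : ∀ w ∈ W, c * ‖w‖ ^ 2 ≤ ⟪T w, w⟫_ℝ) : c ≤ hT.eigenvalues hn k := by
  obtain ⟨W', hW', h'⟩ := hT.exists_inner_le hn k
  obtain ⟨w, hw, hw', hw0⟩ := Submodule.exists_mem_ne_zero_of_finrank_lt
    (W := W) (W' := W') (by have := k.2; omega)
  exact le_of_mul_le_mul_right ((h w hw).trans (h' w hw')) (by positivity)

/-- An upper bound for the quadratic form of `T` on a subspace of codimension `k` bounds the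
`k`-th largest eigenvalue from above. -/
theorem LinearMap.IsSymmetric.eigenvalues_le (hT : T.IsSymmetric) (hn : finrank ℝ V = n)
    (k : Fin n) (W : Submodule ℝ V) (hW : n ≤ finrank ℝ W + k) (c : ℝ)
    (h : ∀ w ∈ W, ⟪T w, w⟫_ℝ ≤ c * ‖w‖ ^ 2) : hT.eigenvalues hn k ≤ c := by
  obtain ⟨W', hW', h'⟩ := hT.exists_le_inner hn k
  obtain ⟨w, hw, hw', hw0⟩ := Submodule.exists_mem_ne_zero_of_finrank_lt
    (W := W) (W' := W') (by have := k.2; omega)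
  exact le_of_mul_le_mul_right ((h' w hw').trans (h w hw)) (by positivity)

/-- Weyl monotonicity. -/
theorem LinearMap.IsSymmetric.eigenvalues_mono {T' : V →ₗ[ℝ] V} (hT : T.IsSymmetric)
    (hT' : T'.IsSymmetric) (hn : finrank ℝ V = n) (h : ∀ w, ⟪T w, w⟫_ℝ ≤ ⟪T' w, w⟫_ℝ)
    (k : Fin n) : hT.eigenvalues hn k ≤ hT'.eigenvalues hn k := by
  obtain ⟨W, hW, h'⟩ := hT.exists_le_inner hn k
  exact hT'.le_eigenvalues hn k W hW.ge _ fun w hw => (h' w hw).trans (h w)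

/-- The eigenvalues move by at most the trace of a positive perturbation. -/
theorem LinearMap.IsSymmetric.sum_abs_eigenvalues_sub_eq_trace {T' : V →ₗ[ℝ] V} (hT : T.IsSymmetric)
    (hT' : T'.IsSymmetric) (hn : finrank ℝ V = n) (h : ∀ w, ⟪T w, w⟫_ℝ ≤ ⟪T' w, w⟫_ℝ) :
    ∑ k, |hT'.eigenvalues hn k - hT.eigenvalues hn k| = (T' - T).trace ℝ V := by
  have h1 := hT.trace_eq_sum_eigenvalues hn
  have h2 := hT'.trace_eq_sum_eigenvalues hn
  simp only [RCLike.ofReal_real_eq_id, id_eq] at h1 h2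
  rw [map_sub, h1, h2, ← Finset.sum_sub_distrib]
  exact Finset.sum_congr rfl fun k _ =>
    abs_of_nonneg (sub_nonneg.2 (hT.eigenvalues_mono hT' hn h k))

end CourantFischer

/-! ### Variational bounds for singular values -/

section SingularValues

variable {V F : Type*} [NormedAddCommGroup V] [InnerProductSpace ℝ V] [FiniteDimensional ℝ V]
  [NormedAddCommGroup F] [InnerProductSpace ℝ F] [FiniteDimensional ℝ F] (T : V →ₗ[ℝ] F)

theorem LinearMap.inner_adjoint_comp_self_apply (w : V) :
    ⟪(LinearMap.adjoint T ∘ₗ T) w, w⟫_ℝ = ‖T w‖ ^ 2 := by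
  rw [LinearMap.comp_apply, LinearMap.adjoint_inner_left, real_inner_self_eq_norm_sq]

theorem LinearMap.exists_singularValues_mul_norm_le {k : ℕ} (hk : k < finrank ℝ V) :
    ∃ W : Submodule ℝ V, finrank ℝ W = k + 1 ∧ ∀ w ∈ W, T.singularValues k * ‖w‖ ≤ ‖T w‖ := by
  obtain ⟨W, hW, h⟩ := T.isSymmetric_adjoint_comp_self.exists_le_inner rfl ⟨k, hk⟩
  refine ⟨W, hW, fun w hw => ?_⟩
  have h1 := h w hw
  rw [T.inner_adjoint_comp_self_apply, ← T.sq_singularValues_of_lt rfl hk, ← mul_pow] at h1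
  exact le_of_sq_le_sq h1 (norm_nonneg _)

theorem LinearMap.exists_norm_le_singularValues_mul (k : ℕ) :
    ∃ W : Submodule ℝ V, finrank ℝ V ≤ finrank ℝ W + k ∧
      ∀ w ∈ W, ‖T w‖ ≤ T.singularValues k * ‖w‖ := by
  rcases lt_or_ge k (finrank ℝ V) with hk | hk
  · obtain ⟨W, hW, h⟩ := T.isSymmetric_adjoint_comp_self.exists_inner_le rfl ⟨k, hk⟩
    refine ⟨W, by simp only at hW; omega, fun w hw => ?_⟩
    have h1 := h w hw
    rw [T.inner_adjoint_comp_self_apply, ← T.sq_singularValues_of_lt rfl hk, ← mul_pow] at h1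
    exact le_of_sq_le_sq h1 (mul_nonneg (T.singularValues_nonneg k) (norm_nonneg _))
  · refine ⟨⊥, by omega, fun w hw => ?_⟩
    rw [(Submodule.mem_bot ℝ).1 hw]
    simp

theorem LinearMap.singularValues_le {k : ℕ} (W : Submodule ℝ V)
    (hW : finrank ℝ V ≤ finrank ℝ W + k) {c : ℝ} (hc : 0 ≤ c) (h : ∀ w ∈ W, ‖T w‖ ≤ c * ‖w‖) :
    T.singularValues k ≤ c := by
  rcases lt_or_ge k (finrank ℝ V) with hk | hk
  · obtain ⟨W', hW', h'⟩ := T.exists_singularValues_mul_norm_le hk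
    obtain ⟨w, hw, hw', hw0⟩ := Submodule.exists_mem_ne_zero_of_finrank_lt
      (W := W) (W' := W') (by omega)
    exact le_of_mul_le_mul_right ((h' w hw').trans (h w hw)) (by positivity)
  · rwa [T.singularValues_of_finrank_le hk]

/-- These are right singular vectors: an eigenbasis of `T† T`. -/
theorem LinearMap.exists_orthonormalBasis_norm_eq_singularValues {n : ℕ} (hn : finrank ℝ V = n) :
    ∃ b : OrthonormalBasis (Fin n) ℝ V, ∀ i, ‖T (b i)‖ = T.singularValues i := by
  refine ⟨T.isSymmetric_adjoint_comp_self.eigenvectorBasis hn, fun i => ?_⟩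
  rw [← sq_eq_sq₀ (norm_nonneg _) (T.singularValues_nonneg i), T.sq_singularValues_fin hn,
    ← T.inner_adjoint_comp_self_apply, LinearMap.IsSymmetric.apply_eigenvectorBasis,
    inner_smul_left, real_inner_self_eq_norm_sq]
  simp

/-- Both sides are the trace of `T† T`, which any orthonormal basis computes. -/
theorem LinearMap.sum_sq_singularValues {n : ℕ} (b : OrthonormalBasis (Fin n) ℝ V) :
    ∑ i ∈ Finset.range n, T.singularValues i ^ 2 = ∑ i, ‖T (b i)‖ ^ 2 := by
  have hn : finrank ℝ V = n := by simp [Module.finrank_eq_card_basis b.toBasis]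
  rw [Finset.sum_range]
  simp_rw [T.sq_singularValues_fin hn]
  have h1 := T.isSymmetric_adjoint_comp_self.trace_eq_sum_eigenvalues hn
  simp only [RCLike.ofReal_real_eq_id, id_eq] at h1
  rw [← h1, LinearMap.trace_eq_sum_inner _ b]
  refine Finset.sum_congr rfl fun i _ => ?_
  rw [real_inner_comm, T.inner_adjoint_comp_self_apply]

theorem LinearMap.singularValues_neg : (-T).singularValues = T.singularValues := by
  ext k
  apply le_antisymm
  · obtain ⟨W, hW, h⟩ := T.exists_norm_le_singularValues_mul k
    exact (-T).singularValues_le W hW (T.singularValues_nonneg k) (by simpa using h)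
  · obtain ⟨W, hW, h⟩ := (-T).exists_norm_le_singularValues_mul k
    exact T.singularValues_le W hW ((-T).singularValues_nonneg k) (by simpa using h)

/-- Half of the interlacing: intersecting a test space for `T` with the hyperplane `v⊥`, where the
maps agree, costs at most one more codimension. -/
theorem LinearMap.singularValues_succ_le_of_rank_one (S : V →ₗ[ℝ] F) (v : V)
    (h : ∀ w, ⟪v, w⟫_ℝ = 0 → S w = T w) (k : ℕ) :
    S.singularValues (k + 1) ≤ T.singularValues k := by
  obtain ⟨W, hW, hT⟩ := T.exists_norm_le_singularValues_mul k
  refine S.singularValues_le (W ⊓ (ℝ ∙ v)ᗮ) ?_ (T.singularValues_nonneg k) ?_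
  · have h1 := Submodule.finrank_sup_add_finrank_inf_eq W (ℝ ∙ v)ᗮ
    have h2 := Submodule.finrank_le (W ⊔ (ℝ ∙ v)ᗮ)
    have h3 := Submodule.finrank_add_finrank_orthogonal (ℝ ∙ v)
    have h4 : finrank ℝ (ℝ ∙ v) ≤ 1 := by
      simpa using finrank_span_le_card (R := ℝ) ({v} : Set V)
    omega
  · intro w hw
    rw [h w (Submodule.mem_orthogonal_singleton_iff_inner_right.1 hw.2)]
    exact hT w hw.1

end SingularValues

/-! ### Self-adjoint dilation and rank-one Mirsky inequality -/

section Dilation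

variable {V F : Type*} [NormedAddCommGroup V] [InnerProductSpace ℝ V] [FiniteDimensional ℝ V]
  [NormedAddCommGroup F] [InnerProductSpace ℝ F] [FiniteDimensional ℝ F]

/-- If the quadratic form of `T` changes sign under an isometry, then the spectrum of `T` is
symmetric about zero. -/
theorem LinearMap.IsSymmetric.eigenvalues_rev {n : ℕ} {T : V →ₗ[ℝ] V} (hT : T.IsSymmetric)
    (hn : finrank ℝ V = n) (R : V →ₗᵢ[ℝ] V) (h : ∀ w, ⟪T (R w), R w⟫_ℝ = -⟪T w, w⟫_ℝ)
    (k : Fin n) : hT.eigenvalues hn k.rev = -hT.eigenvalues hn k := by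
  have hfin : ∀ W : Submodule ℝ V, finrank ℝ (W.map R.toLinearMap) = finrank ℝ W := fun W =>
    (Submodule.equivMapOfInjective R.toLinearMap R.injective W).finrank_eq.symm
  apply le_antisymm
  · obtain ⟨W, hW, hW'⟩ := hT.exists_le_inner hn k
    refine hT.eigenvalues_le hn _ (W.map R.toLinearMap) ?_ _ ?_
    · rw [hfin, hW, Fin.val_rev]
      omega
    · rintro _ ⟨w, hw, rfl⟩
      have := hW' w hw
      simp only [LinearIsometry.coe_toLinearMap, h, LinearIsometry.norm_map]
      linarith
  · obtain ⟨W, hW, hW'⟩ := hT.exists_inner_le hn k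
    refine hT.le_eigenvalues hn _ (W.map R.toLinearMap) ?_ _ ?_
    · rw [hfin, hW, Fin.val_rev]
      omega
    · rintro _ ⟨w, hw, rfl⟩
      have := hW' w hw
      simp only [LinearIsometry.coe_toLinearMap, h, LinearIsometry.norm_map]
      linarith

/-- The self-adjoint dilation `(u, v) ↦ (M v, M† u)` of `M`. -/
noncomputable def LinearMap.dilation (M : V →ₗ[ℝ] F) :
    WithLp 2 (F × V) →ₗ[ℝ] WithLp 2 (F × V) :=
  (WithLp.linearEquiv 2 ℝ (F × V)).symm.toLinearMap ∘ₗ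
    ((M ∘ₗ LinearMap.snd ℝ F V).prod (LinearMap.adjoint M ∘ₗ LinearMap.fst ℝ F V)) ∘ₗ
      (WithLp.linearEquiv 2 ℝ (F × V)).toLinearMap

theorem LinearMap.inner_dilation_apply (M : V →ₗ[ℝ] F) (x y : WithLp 2 (F × V)) :
    ⟪M.dilation x, y⟫_ℝ = ⟪M x.snd, y.fst⟫_ℝ + ⟪x.fst, M y.snd⟫_ℝ := by
  rw [WithLp.prod_inner_apply, ← LinearMap.adjoint_inner_left]
  rfl

theorem LinearMap.dilation_isSymmetric (M : V →ₗ[ℝ] F) : M.dilation.IsSymmetric := by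
  intro x y
  rw [M.inner_dilation_apply, real_inner_comm (M.dilation y), M.inner_dilation_apply,
    real_inner_comm y.fst, real_inner_comm x.fst, add_comm]

theorem LinearMap.inner_dilation_self (M : V →ₗ[ℝ] F) (x : WithLp 2 (F × V)) :
    ⟪M.dilation x, x⟫_ℝ = 2 * ⟪x.fst, M x.snd⟫_ℝ := by
  rw [M.inner_dilation_apply, real_inner_comm]
  ring

theorem LinearMap.eigenvalues_dilation_rev (M : V →ₗ[ℝ] F) {N : ℕ}
    (hN : finrank ℝ (WithLp 2 (F × V)) = N) (k : Fin N) :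
    M.dilation_isSymmetric.eigenvalues hN k.rev = -M.dilation_isSymmetric.eigenvalues hN k := by
  -- The isometry `(u, v) ↦ (u, -v)` reverses the sign of the quadratic form `2 ⟪u, M v⟫`.
  let R : WithLp 2 (F × V) →ₗᵢ[ℝ] WithLp 2 (F × V) :=
    { toLinearMap := (WithLp.linearEquiv 2 ℝ (F × V)).symm.toLinearMap ∘ₗ
        ((LinearMap.fst ℝ F V).prod (-LinearMap.snd ℝ F V)) ∘ₗ
          (WithLp.linearEquiv 2 ℝ (F × V)).toLinearMap
      norm_map' := fun x => by
        rw [← sq_eq_sq₀ (norm_nonneg _) (norm_nonneg _), WithLp.prod_norm_sq_eq_of_L2,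
          WithLp.prod_norm_sq_eq_of_L2]
        simp }
  refine M.dilation_isSymmetric.eigenvalues_rev hN R (fun w => ?_) k
  rw [M.inner_dilation_self, M.inner_dilation_self]
  have h1 : (R w).fst = w.fst := rfl
  have h2 : (R w).snd = -w.snd := rfl
  rw [h1, h2, map_neg, inner_neg_right]
  ring

theorem LinearMap.trace_dilation (M : V →ₗ[ℝ] F) : M.dilation.trace ℝ _ = 0 := by
  have h := M.dilation_isSymmetric.trace_eq_sum_eigenvalues rfl
  simp only [RCLike.ofReal_real_eq_id, id_eq] at h
  have h2 := Equiv.sum_comp Fin.revPerm (M.dilation_isSymmetric.eigenvalues rfl)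
  simp only [Fin.revPerm_apply, M.eigenvalues_dilation_rev, Finset.sum_neg_distrib] at h2
  rw [h]
  linarith

theorem LinearMap.eigenvalues_dilation_eq_singularValues (M : V →ₗ[ℝ] F) {N : ℕ}
    (hN : finrank ℝ (WithLp 2 (F × V)) = N) (k : Fin N) (hk : (k : ℕ) < finrank ℝ V) :
    M.dilation_isSymmetric.eigenvalues hN k = M.singularValues k := by
  have hfin : finrank ℝ (WithLp 2 (F × V)) = finrank ℝ F + finrank ℝ V := by
    rw [(WithLp.linearEquiv 2 ℝ (F × V)).finrank_eq, Module.finrank_prod]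
  have hnn := M.singularValues_nonneg k
  apply le_antisymm
  -- Test space `F × W`, with `W` of codimension at most `k` in `V`.
  · obtain ⟨W, hW, h⟩ := M.exists_norm_le_singularValues_mul k
    let J : F × W →ₗ[ℝ] WithLp 2 (F × V) := (WithLp.linearEquiv 2 ℝ (F × V)).symm.toLinearMap ∘ₗ
      (LinearMap.id.prodMap W.subtype)
    have hJ : Function.Injective J := by
      refine (WithLp.linearEquiv 2 ℝ (F × V)).symm.injective.comp ?_
      exact Function.Injective.prodMap Function.injective_id W.injective_subtype
    refine M.dilation_isSymmetric.eigenvalues_le hN k (LinearMap.range J) ?_ _ ?_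
    · rw [LinearMap.finrank_range_of_inj hJ, Module.finrank_prod]
      omega
    · rintro _ ⟨⟨u, w⟩, rfl⟩
      rw [M.inner_dilation_self, WithLp.prod_norm_sq_eq_of_L2]
      change 2 * ⟪u, M (w : V)⟫_ℝ ≤ _ * (‖u‖ ^ 2 + ‖(w : V)‖ ^ 2)
      have h1 := real_inner_le_norm u (M (w : V))
      have h2 := mul_le_mul_of_nonneg_left (h w w.2) (norm_nonneg u)
      have h3 := mul_nonneg hnn (sq_nonneg (‖u‖ - ‖(w : V)‖))
      nlinarith
  · rcases hnn.eq_or_lt with h0 | hpos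
    · rw [← h0]
      let J : V →ₗ[ℝ] WithLp 2 (F × V) := (WithLp.linearEquiv 2 ℝ (F × V)).symm.toLinearMap ∘ₗ
        LinearMap.inr ℝ F V
      have hJ : Function.Injective J :=
        (WithLp.linearEquiv 2 ℝ (F × V)).symm.injective.comp LinearMap.inr_injective
      refine M.dilation_isSymmetric.le_eigenvalues hN k (LinearMap.range J) ?_ _ ?_
      · rw [LinearMap.finrank_range_of_inj hJ]
        omega
      · rintro _ ⟨v, rfl⟩
        rw [M.inner_dilation_self]
        change _ ≤ 2 * ⟪(0 : F), M v⟫_ℝ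
        simp
    · obtain ⟨W, hW, h⟩ := M.exists_singularValues_mul_norm_le hk
      -- Test vectors `(M w, σ_k w)`, modelled on the eigenvectors `(M v, σ v)` of the dilation. The
      -- map is injective only for `σ_k > 0`, hence the separate case above.
      let J : V →ₗ[ℝ] WithLp 2 (F × V) := (WithLp.linearEquiv 2 ℝ (F × V)).symm.toLinearMap ∘ₗ
        (M.prod (M.singularValues k • LinearMap.id))
      have hJ : Function.Injective J := by
        refine (WithLp.linearEquiv 2 ℝ (F × V)).symm.injective.comp ?_
        intro x y hxy
        exact smul_right_injective V hpos.ne' (congrArg Prod.snd hxy)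
      refine M.dilation_isSymmetric.le_eigenvalues hN k (W.map J) ?_ _ ?_
      · rw [← (Submodule.equivMapOfInjective J hJ W).finrank_eq, hW]
      · rintro _ ⟨w, hw, rfl⟩
        rw [M.inner_dilation_self, WithLp.prod_norm_sq_eq_of_L2]
        change M.singularValues k * (‖M w‖ ^ 2 + ‖M.singularValues k • w‖ ^ 2) ≤
          2 * ⟪M w, M (M.singularValues k • w)⟫_ℝ
        rw [map_smul, inner_smul_right, real_inner_self_eq_norm_sq, norm_smul, Real.norm_eq_abs,
          abs_of_pos hpos]
        have h1 := pow_le_pow_left₀ (by positivity) (h w hw) 2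
        nlinarith

/-- Mirsky's inequality for a perturbation of rank one. -/
theorem LinearMap.sum_abs_singularValues_sub_le_of_rank_one (A B : V →ₗ[ℝ] F) (v : V) (w : F)
    (hv : ‖v‖ = 1) (hAB : ∀ x, A x = B x + ⟪v, x⟫_ℝ • w) :
    ∑ k ∈ Finset.range (min (finrank ℝ F) (finrank ℝ V)),
      |A.singularValues k - B.singularValues k| ≤ ‖w‖ := by
  rcases eq_or_ne w 0 with rfl | hw
  · have : A = B := by ext x; simp [hAB]
    simp [this]
  set d := min (finrank ℝ F) (finrank ℝ V) with hd
  have hfin : finrank ℝ (WithLp 2 (F × V)) = finrank ℝ F + finrank ℝ V := by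
    rw [(WithLp.linearEquiv 2 ℝ (F × V)).finrank_eq, Module.finrank_prod]
  have hwpos : 0 < ‖w‖ := norm_pos_iff.2 hw
  let x : WithLp 2 (F × V) := WithLp.toLp 2 (‖w‖⁻¹ • w, v)
  have hx : ⟪x, x⟫_ℝ = 2 := by
    rw [WithLp.prod_inner_apply]
    change ⟪‖w‖⁻¹ • w, ‖w‖⁻¹ • w⟫_ℝ + ⟪v, v⟫_ℝ = 2
    rw [real_inner_self_eq_norm_sq, real_inner_self_eq_norm_sq, norm_smul, norm_inv, norm_norm,
      inv_mul_cancel₀ hwpos.ne', hv]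
    norm_num
  -- `Q` is positive of trace `‖w‖`. By `4αβ ≤ (α + β)²`, the operator `B.dilation + Q` dominates
  -- both dilations, so each spectrum is at distance exactly `‖w‖` from that of `P`.
  let Q : WithLp 2 (F × V) →ₗ[ℝ] WithLp 2 (F × V) :=
    (‖w‖ / 2) • (InnerProductSpace.rankOne ℝ x x).toLinearMap
  have hQ : ∀ y z, ⟪Q y, z⟫_ℝ = ‖w‖ / 2 * (⟪x, y⟫_ℝ * ⟪x, z⟫_ℝ) := by
    intro y z
    simp [Q, inner_smul_left]
  let P := B.dilation + Q
  have hP : P.IsSymmetric := by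
    refine B.dilation_isSymmetric.add fun y z => ?_
    rw [hQ, real_inner_comm (Q z) y, hQ]
    ring
  have htr : P.trace ℝ _ = ‖w‖ := by
    simp only [P, Q, map_add, B.trace_dilation, map_smul, InnerProductSpace.trace_rankOne, hx]
    simp
  have hform : ∀ z, ⟪P z, z⟫_ℝ = ⟪B.dilation z, z⟫_ℝ + ‖w‖ / 2 * ⟪x, z⟫_ℝ ^ 2 := by
    intro z
    rw [LinearMap.add_apply, inner_add_left, hQ]
    ring
  have hB := B.dilation_isSymmetric.sum_abs_eigenvalues_sub_eq_trace hP rfl (fun z => by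
    rw [hform]
    have : 0 ≤ ‖w‖ / 2 * ⟪x, z⟫_ℝ ^ 2 := by positivity
    linarith)
  have hA := A.dilation_isSymmetric.sum_abs_eigenvalues_sub_eq_trace hP rfl (fun z => by
    rw [hform, A.inner_dilation_self, B.inner_dilation_self, hAB, inner_add_right,
      inner_smul_right, WithLp.prod_inner_apply]
    change _ ≤ _ + ‖w‖ / 2 * (⟪‖w‖⁻¹ • w, z.fst⟫_ℝ + ⟪v, z.snd⟫_ℝ) ^ 2
    have h1 : ⟪z.fst, w⟫_ℝ = ‖w‖ * ⟪‖w‖⁻¹ • w, z.fst⟫_ℝ := by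
      rw [inner_smul_left, real_inner_comm]
      simp [hwpos.ne']
    rw [h1]
    have := mul_nonneg hwpos.le (sq_nonneg (⟪‖w‖⁻¹ • w, z.fst⟫_ℝ - ⟪v, z.snd⟫_ℝ))
    nlinarith)
  rw [map_sub, htr, LinearMap.trace_dilation, sub_zero] at hA hB
  set a := A.dilation_isSymmetric.eigenvalues rfl with ha
  set b := B.dilation_isSymmetric.eigenvalues rfl with hb
  have hsum : ∑ k, |a k - b k| ≤ 2 * ‖w‖ := by
    calc ∑ k, |a k - b k| ≤ ∑ k, (|hP.eigenvalues rfl k - a k| + |hP.eigenvalues rfl k - b k|) := by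
          refine Finset.sum_le_sum fun k _ => ?_
          rw [abs_sub_comm (hP.eigenvalues rfl k) (a k)]
          exact abs_sub_le _ _ _
      _ = 2 * ‖w‖ := by rw [Finset.sum_add_distrib, hA, hB]; ring
  have hdN : d ≤ finrank ℝ (WithLp 2 (F × V)) := by omega
  -- The first `d` and last `d` indices are disjoint since `2 * d` is at most the dimension. By
  -- symmetry of the spectrum each singular value difference is counted twice, which cancels the
  -- factor in `2 * ‖w‖`.
  let e : Fin d ⊕ Fin d ↪ Fin (finrank ℝ (WithLp 2 (F × V))) :=
    ⟨Sum.elim (Fin.castLE hdN) (fun i => (Fin.castLE hdN i).rev), by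
      rintro (i | i) (j | j) hij <;>
        simp only [Sum.elim_inl, Sum.elim_inr, Fin.ext_iff, Fin.val_rev, Fin.val_castLE] at hij
      · exact congrArg _ (Fin.ext hij)
      · omega
      · omega
      · exact congrArg _ (Fin.ext (by omega))⟩
  have hle : ∑ i, |a (e i) - b (e i)| ≤ ∑ k, |a k - b k| := by
    rw [← Finset.sum_map Finset.univ e (fun k => |a k - b k|)]
    exact Finset.sum_le_univ_sum_of_nonneg fun _ => abs_nonneg _
  rw [Fintype.sum_sum_type] at hle
  have h1 : ∀ i : Fin d, |a (e (Sum.inl i)) - b (e (Sum.inl i))| =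
      |A.singularValues i - B.singularValues i| := by
    intro i
    have hi : ((e (Sum.inl i) : Fin _) : ℕ) = i := rfl
    have hi' : ((e (Sum.inl i) : Fin _) : ℕ) < finrank ℝ V := by rw [hi]; omega
    rw [ha, hb, A.eigenvalues_dilation_eq_singularValues rfl _ hi',
      B.eigenvalues_dilation_eq_singularValues rfl _ hi', hi]
  have h2 : ∀ i : Fin d, |a (e (Sum.inr i)) - b (e (Sum.inr i))| =
      |A.singularValues i - B.singularValues i| := by
    intro i
    rw [← h1]
    have hi : e (Sum.inr i) = (e (Sum.inl i)).rev := rfl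
    rw [hi, ha, hb, A.eigenvalues_dilation_rev, B.eigenvalues_dilation_rev, ← abs_neg]
    congr 1
    ring
  simp_rw [h1, h2] at hle
  rw [Finset.sum_range]
  linarith

end Dilation

/-! ### Concave functions on interlacing sequences -/

section Interlacing

/-- The points `s + δ` and `t` are convex combinations of `s` and `t + δ` with swapped weights;
adding the two concavity inequalities gives the claim. -/
theorem ConcaveOn.add_sub_le_add_sub {f : ℝ → ℝ} (hf : ConcaveOn ℝ (Set.Ici 0) f) {s t δ : ℝ}
    (hs : 0 ≤ s) (hst : s ≤ t) (hδ : 0 ≤ δ) : f (t + δ) - f t ≤ f (s + δ) - f s := by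
  rcases (add_nonneg (sub_nonneg.2 hst) hδ).eq_or_lt with h0 | hpos
  · have h1 : δ = 0 := by linarith
    simp [h1]
  · set c := t - s + δ with hc
    have hs' : s ∈ Set.Ici (0 : ℝ) := hs
    have ht' : t + δ ∈ Set.Ici (0 : ℝ) := by simp only [Set.mem_Ici]; linarith
    have hsum : (t - s) / c + δ / c = 1 := by rw [← add_div, div_self hpos.ne']
    have h1 := hf.2 hs' ht' (div_nonneg (sub_nonneg.2 hst) hpos.le) (div_nonneg hδ hpos.le) hsum
    have h2 := hf.2 hs' ht' (div_nonneg hδ hpos.le) (div_nonneg (sub_nonneg.2 hst) hpos.le)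
      (by rw [add_comm, hsum])
    have e1 : (t - s) / c * s + δ / c * (t + δ) = s + δ := by
      field_simp
      rw [hc]
      ring
    have e2 : δ / c * s + (t - s) / c * (t + δ) = t := by
      field_simp
      rw [hc]
      ring
    simp only [smul_eq_mul, e1, e2] at h1 h2
    have h3 : f s + f (t + δ) = ((t - s) / c * f s + δ / c * f (t + δ)) +
        (δ / c * f s + (t - s) / c * f (t + δ)) := by
      linear_combination (-(f s + f (t + δ))) * hsum
    linarith

/-- Interlacing makes the intervals between `a i` and `b i` non-overlapping, and all lie in `[0, max
(a 0) (b 0)]`. -/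
theorem sum_abs_sub_le_max_of_interlacing (d : ℕ) {a b : ℕ → ℝ} (ha : Antitone a)
    (hb : Antitone b) (ha0 : ∀ i, 0 ≤ a i) (hb0 : ∀ i, 0 ≤ b i) (hab : ∀ i, a (i + 1) ≤ b i)
    (hba : ∀ i, b (i + 1) ≤ a i) :
    ∑ i ∈ Finset.range d, |a i - b i| ≤ max (a 0) (b 0) := by
  induction d generalizing a b with
  | zero => simpa using Or.inl (ha0 0)
  | succ d ih =>
    rw [Finset.sum_range_succ']
    have h1 := ih (a := fun i => a (i + 1)) (b := fun i => b (i + 1))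
      (fun i j h => ha (by omega)) (fun i j h => hb (by omega)) (fun i => ha0 _) (fun i => hb0 _)
      (fun i => hab _) (fun i => hba _)
    have h2 : max (a 1) (b 1) ≤ min (a 0) (b 0) :=
      max_le (le_min (ha zero_le_one) (hab 0)) (le_min (hba 0) (hb zero_le_one))
    rw [← max_sub_min_eq_abs' (a 0) (b 0)]
    simp only [zero_add] at h1
    linarith

/-- A concave function increases the total length of interlacing intervals at most as if they were
moved next to each other and to the origin. -/
theorem sum_abs_map_sub_le_of_interlacing {f : ℝ → ℝ} (hf : ConcaveOn ℝ (Set.Ici 0) f)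
    (hfm : MonotoneOn f (Set.Ici 0)) (hf0 : f 0 = 0) (d : ℕ) {a b : ℕ → ℝ} (ha : Antitone a)
    (hb : Antitone b) (ha0 : ∀ i, 0 ≤ a i) (hb0 : ∀ i, 0 ≤ b i) (hab : ∀ i, a (i + 1) ≤ b i)
    (hba : ∀ i, b (i + 1) ≤ a i) :
    ∑ i ∈ Finset.range d, |f (a i) - f (b i)| ≤ f (∑ i ∈ Finset.range d, |a i - b i|) := by
  induction d generalizing a b with
  | zero => simp [hf0]
  | succ d ih =>
    rw [Finset.sum_range_succ', Finset.sum_range_succ']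
    have hsh := sum_abs_sub_le_max_of_interlacing d (a := fun i => a (i + 1))
      (b := fun i => b (i + 1))
      (fun i j h => ha (by omega)) (fun i j h => hb (by omega)) (fun i => ha0 _) (fun i => hb0 _)
      (fun i => hab _) (fun i => hba _)
    have h1 := ih (a := fun i => a (i + 1)) (b := fun i => b (i + 1))
      (fun i j h => ha (by omega)) (fun i j h => hb (by omega)) (fun i => ha0 _) (fun i => hb0 _)
      (fun i => hab _) (fun i => hba _)
    have h2 : max (a 1) (b 1) ≤ min (a 0) (b 0) :=
      max_le (le_min (ha zero_le_one) (hab 0)) (le_min (hba 0) (hb zero_le_one))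
    set S := ∑ i ∈ Finset.range d, |a (i + 1) - b (i + 1)|
    have hS : 0 ≤ S := Finset.sum_nonneg fun _ _ => abs_nonneg _
    -- The later intervals have total length `S ≤ min (a 0) (b 0)`, so sliding the top interval left
    -- to start at `S` can only increase the increment of `f`.
    have h3 := hf.add_sub_le_add_sub hS (hsh.trans h2) (abs_nonneg (a 0 - b 0))
    have h4 : |f (a 0) - f (b 0)| = f (min (a 0) (b 0) + |a 0 - b 0|) - f (min (a 0) (b 0)) := by
      rw [← max_sub_min_eq_abs' (a 0) (b 0), add_sub_cancel]
      rcases le_total (a 0) (b 0) with h | h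
      · rw [max_eq_right h, min_eq_left h, abs_sub_comm]
        exact abs_of_nonneg (sub_nonneg.2 (hfm (ha0 0) (hb0 0) h))
      · rw [max_eq_left h, min_eq_right h]
        exact abs_of_nonneg (sub_nonneg.2 (hfm (hb0 0) (ha0 0) h))
    rw [h4]
    linarith

end Interlacing

/-! ### Mirsky's inequality for concave functions -/

section ConcaveMirsky

variable {V F : Type*} [NormedAddCommGroup V] [InnerProductSpace ℝ V] [FiniteDimensional ℝ V]
  [NormedAddCommGroup F] [InnerProductSpace ℝ F] [FiniteDimensional ℝ F]

theorem LinearMap.sum_abs_map_singularValues_sub_le_of_rank_one {f : ℝ → ℝ}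
    (hf : ConcaveOn ℝ (Set.Ici 0) f) (hfm : MonotoneOn f (Set.Ici 0)) (hf0 : f 0 = 0)
    (A B : V →ₗ[ℝ] F) (v : V) (w : F) (hv : ‖v‖ = 1) (hAB : ∀ x, A x = B x + ⟪v, x⟫_ℝ • w) :
    ∑ k ∈ Finset.range (min (finrank ℝ F) (finrank ℝ V)),
      |f (A.singularValues k) - f (B.singularValues k)| ≤ f ‖w‖ := by
  refine (sum_abs_map_sub_le_of_interlacing hf hfm hf0 _ A.singularValues_antitone
    B.singularValues_antitone A.singularValues_nonneg B.singularValues_nonneg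
    (B.singularValues_succ_le_of_rank_one A v fun x hx => ?_)
    (A.singularValues_succ_le_of_rank_one B v fun x hx => ?_)).trans ?_
  · simp [hAB, hx]
  · simp [hAB, hx]
  · exact hfm (Set.mem_Ici.2 (Finset.sum_nonneg fun _ _ => abs_nonneg _)) (norm_nonneg _)
      (A.sum_abs_singularValues_sub_le_of_rank_one B v w hv hAB)

/-- Mirsky's inequality for concave functions of the singular values. -/
theorem LinearMap.sum_abs_map_singularValues_sub_le {f : ℝ → ℝ} (hf : ConcaveOn ℝ (Set.Ici 0) f)
    (hfm : MonotoneOn f (Set.Ici 0)) (hf0 : f 0 = 0) (A B : V →ₗ[ℝ] F) :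
    ∑ k ∈ Finset.range (min (finrank ℝ F) (finrank ℝ V)),
      |f (A.singularValues k) - f (B.singularValues k)| ≤
    ∑ k ∈ Finset.range (min (finrank ℝ F) (finrank ℝ V)), f ((A - B).singularValues k) := by
  obtain ⟨b, hb⟩ := (A - B).exists_orthonormalBasis_norm_eq_singularValues rfl
  let E : Fin (finrank ℝ V) → V →ₗ[ℝ] F := fun i =>
    (InnerProductSpace.rankOne ℝ ((A - B) (b i)) (b i)).toLinearMap
  have hE : ∀ i x, E i x = ⟪b i, x⟫_ℝ • (A - B) (b i) := fun i x => by
    simp [E, smul_sub]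
  -- Adding the rank-one pieces of `A - B` one at a time, the piece along `b i` costs `f ‖(A - B) (b
  -- i)‖ = f (σ_i (A - B))`.
  have key : ∀ S : Finset (Fin (finrank ℝ V)),
      ∑ k ∈ Finset.range (min (finrank ℝ F) (finrank ℝ V)),
        |f ((B + ∑ i ∈ S, E i).singularValues k) - f (B.singularValues k)| ≤
      ∑ i ∈ S, f ((A - B).singularValues i) := by
    intro S
    induction S using Finset.induction_on with
    | empty => simp
    | insert j S hj ih =>
      have h1 := LinearMap.sum_abs_map_singularValues_sub_le_of_rank_one hf hfm hf0
        (B + ∑ i ∈ insert j S, E i) (B + ∑ i ∈ S, E i) (b j) ((A - B) (b j))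
        (b.orthonormal.1 j) (fun x => by
          rw [Finset.sum_insert hj, ← hE, LinearMap.add_apply, LinearMap.add_apply,
            LinearMap.add_apply]
          abel)
      rw [hb] at h1
      rw [Finset.sum_insert (f := fun i : Fin _ => f ((A - B).singularValues i)) hj]
      refine le_trans ?_ (add_le_add h1 ih)
      rw [← Finset.sum_add_distrib]
      exact Finset.sum_le_sum fun k _ => abs_sub_le _ _ _
  have hA : B + ∑ i, E i = A := by
    ext x
    rw [LinearMap.add_apply, LinearMap.sum_apply]
    simp_rw [hE]
    rw [add_comm, ← eq_sub_iff_add_eq, ← LinearMap.sub_apply]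
    conv_rhs => rw [← b.sum_repr' x, map_sum]
    simp
  have h1 := key Finset.univ
  rw [hA] at h1
  refine h1.trans (le_of_eq ?_)
  rw [← Finset.sum_range (fun i => f ((A - B).singularValues i))]
  refine (Finset.sum_subset (Finset.range_subset_range.2 (min_le_right _ _)) fun i hi hi' => ?_).symm
  rw [(A - B).singularValues_eq_zero_iff_le_finrank_range.2, hf0]
  have := Submodule.finrank_le (LinearMap.range (A - B))
  simp only [Finset.mem_range] at hi hi'
  omega

end ConcaveMirsky

/-! ### Block estimates for decreasing sequences -/

section BlockEstimates

theorem Finset.sum_range_sum_Ico_mul {M : Type*} [AddCommMonoid M] (f : ℕ → M) (r s K : ℕ) :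
    ∑ i ∈ Finset.range K, ∑ j ∈ Finset.Ico (r + i * s) (r + (i + 1) * s), f j =
      ∑ j ∈ Finset.Ico r (r + K * s), f j := by
  induction K with
  | zero => simp
  | succ K ih =>
    rw [Finset.sum_range_succ, ih, Finset.sum_Ico_consecutive _ (by omega)]
    nlinarith

theorem Real.sum_rpow_le_rpow_sum {ι : Type*} (S : Finset ι) {f : ι → ℝ} (hf : ∀ i, 0 ≤ f i)
    {t : ℝ} (ht : 1 ≤ t) : ∑ i ∈ S, f i ^ t ≤ (∑ i ∈ S, f i) ^ t := by
  classical
  induction S using Finset.induction_on with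
  | empty => simp [Real.zero_rpow (by linarith : t ≠ 0)]
  | insert j S hj ih =>
    rw [Finset.sum_insert hj, Finset.sum_insert hj]
    exact (add_le_add_right ih _).trans
      (Real.add_rpow_le_rpow_add (hf j) (Finset.sum_nonneg fun i _ => hf i) ht)

theorem Real.rpow_sum_le_sum_rpow {ι : Type*} (S : Finset ι) {f : ι → ℝ} (hf : ∀ i, 0 ≤ f i)
    {t : ℝ} (ht0 : 0 < t) (ht : t ≤ 1) : (∑ i ∈ S, f i) ^ t ≤ ∑ i ∈ S, f i ^ t := by
  classical
  induction S using Finset.induction_on with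
  | empty => simp [Real.zero_rpow ht0.ne']
  | insert j S hj ih =>
    rw [Finset.sum_insert hj, Finset.sum_insert hj]
    exact (Real.rpow_add_le_add_rpow (hf j) (Finset.sum_nonneg fun i _ => hf i) ht0.le ht).trans
      (add_le_add_right ih _)

variable {σ : ℕ → ℝ} {p q : ℝ}

/-- The `ℓ₂`-norm of a block of a decreasing sequence is controlled by the `ℓ_p`-norm of the
preceding block. -/
theorem sum_sq_rpow_le_of_antitone (hσ : Antitone σ) (hσ0 : ∀ i, 0 ≤ σ i) (hp : 0 < p)
    (hq : 0 < q) {s : ℕ} (hs : 0 < s) (k : ℕ) :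
    (∑ j ∈ Finset.Ico (k + s) (k + s + s), σ j ^ 2) ^ (q / 2) ≤
      (s : ℝ) ^ (q / 2 - q / p) * (∑ j ∈ Finset.Ico k (k + s), σ j ^ p) ^ (q / p) := by
  set P := ∑ j ∈ Finset.Ico k (k + s), σ j ^ p with hP
  have hs' : (0 : ℝ) < s := Nat.cast_pos.2 hs
  have hP0 : 0 ≤ P := Finset.sum_nonneg fun i _ => Real.rpow_nonneg (hσ0 i) p
  have hPs : 0 ≤ P / s := div_nonneg hP0 hs'.le
  -- By monotonicity `σ j ^ p` is at most the mean `P / s` over the preceding block.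
  have h1 : ∀ j ∈ Finset.Ico (k + s) (k + s + s), σ j ^ 2 ≤ (P / s) ^ (2 / p) := by
    intro j hj
    have h2 : σ j ^ p ≤ P / s := by
      rw [le_div_iff₀ hs', mul_comm]
      calc (s : ℝ) * σ j ^ p = ∑ i ∈ Finset.Ico k (k + s), σ j ^ p := by simp
        _ ≤ P := Finset.sum_le_sum fun i hi => Real.rpow_le_rpow (hσ0 j)
            (hσ (by simp only [Finset.mem_Ico] at hi hj; omega)) hp.le
    have h3 := Real.rpow_le_rpow (Real.rpow_nonneg (hσ0 j) p) h2 (by positivity : 0 ≤ 2 / p)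
    rw [← Real.rpow_mul (hσ0 j), mul_div_cancel₀ _ hp.ne'] at h3
    exact_mod_cast h3
  have h2 : ∑ j ∈ Finset.Ico (k + s) (k + s + s), σ j ^ 2 ≤ s * (P / s) ^ (2 / p) := by
    refine (Finset.sum_le_sum h1).trans (le_of_eq ?_)
    simp
  refine (Real.rpow_le_rpow (Finset.sum_nonneg fun i _ => sq_nonneg _) h2
    (by positivity)).trans (le_of_eq ?_)
  rw [Real.mul_rpow hs'.le (by positivity), ← Real.rpow_mul hPs,
    show 2 / p * (q / 2) = q / p by field_simp, Real.div_rpow hP0 hs'.le, Real.rpow_sub hs']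
  ring

/-- The power mean inequality with exponent `2 / p ≥ 1`. -/
theorem sum_range_rpow_le (hσ0 : ∀ i, 0 ≤ σ i) (hp : 0 < p) (hp2 : p ≤ 2) (hq : 0 < q) (r : ℕ) :
    (∑ j ∈ Finset.range r, σ j ^ p) ^ (q / p) ≤
      (r : ℝ) ^ (q / p - q / 2) * (∑ j ∈ Finset.range r, σ j ^ 2) ^ (q / 2) := by
  have h1 := Real.rpow_sum_le_const_mul_sum_rpow_of_nonneg (Finset.range r)
    (f := fun j => σ j ^ p) (p := 2 / p) (by rwa [le_div_iff₀ hp, one_mul])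
    (fun i _ => Real.rpow_nonneg (hσ0 i) p)
  have h2 : ∀ j, (σ j ^ p) ^ (2 / p) = σ j ^ 2 := by
    intro j
    rw [← Real.rpow_mul (hσ0 j), mul_div_cancel₀ _ hp.ne']
    exact_mod_cast rfl
  simp only [h2, Finset.card_range] at h1
  have h0 : 0 ≤ ∑ j ∈ Finset.range r, σ j ^ p :=
    Finset.sum_nonneg fun i _ => Real.rpow_nonneg (hσ0 i) p
  have h3 := Real.rpow_le_rpow (Real.rpow_nonneg h0 _) h1 (by positivity : 0 ≤ q / 2)
  rw [← Real.rpow_mul h0, Real.mul_rpow (by positivity) (Finset.sum_nonneg fun i _ => sq_nonneg _),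
    ← Real.rpow_mul (Nat.cast_nonneg r)] at h3
  convert h3 using 2
  · field_simp
  · congr 1
    field_simp

/-- The sum of the `ℓ₂`-norms of the blocks of length `s` after the first `r + s` terms of a
decreasing sequence whose tail is dominated in `ℓ_p` by its first `r` terms. -/
theorem sum_sum_sq_rpow_le (hσ : Antitone σ) (hσ0 : ∀ i, 0 ≤ σ i) (hp : 0 < p) (hpq : p ≤ q)
    (hp2 : p < 2) {τ : ℝ} (hτ : 0 < τ) {r s : ℕ} (hr : 0 < r)
    (hs : (r : ℝ) * τ ^ (2 * p / ((2 - p) * q)) ≤ s) (K : ℕ)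
    (htail : ∑ j ∈ Finset.Ico r (r + K * s), σ j ^ p ≤ ∑ j ∈ Finset.range r, σ j ^ p) :
    τ * ∑ i ∈ Finset.range K,
        (∑ j ∈ Finset.Ico (r + s + i * s) (r + s + (i + 1) * s), σ j ^ 2) ^ (q / 2) ≤
      (∑ j ∈ Finset.range r, σ j ^ 2) ^ (q / 2) := by
  have hq : 0 < q := hp.trans_le hpq
  have hr' : (0 : ℝ) < r := Nat.cast_pos.2 hr
  have hs' : (0 : ℝ) < s := lt_of_lt_of_le (by positivity) hs
  set P : ℕ → ℝ := fun i => ∑ j ∈ Finset.Ico (r + i * s) (r + (i + 1) * s), σ j ^ p with hP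
  have hP0 : ∀ i, 0 ≤ P i := fun i => Finset.sum_nonneg fun j _ => Real.rpow_nonneg (hσ0 j) p
  set G := ∑ j ∈ Finset.range r, σ j ^ 2 with hG
  have hG0 : 0 ≤ G := Finset.sum_nonneg fun j _ => sq_nonneg _
  have h1 : ∑ i ∈ Finset.range K,
        (∑ j ∈ Finset.Ico (r + s + i * s) (r + s + (i + 1) * s), σ j ^ 2) ^ (q / 2) ≤
      (s : ℝ) ^ (q / 2 - q / p) * ∑ i ∈ Finset.range K, P i ^ (q / p) := by
    rw [Finset.mul_sum]
    refine Finset.sum_le_sum fun i _ => ?_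
    have := sum_sq_rpow_le_of_antitone hσ hσ0 hp hq (Nat.cast_pos.1 hs') (r + i * s)
    have hPi : P i = ∑ j ∈ Finset.Ico (r + i * s) (r + i * s + s), σ j ^ p := by
      simp only [hP]
      rw [show r + (i + 1) * s = r + i * s + s by ring]
    rwa [hPi, show r + s + i * s = r + i * s + s by ring,
      show r + s + (i + 1) * s = r + i * s + s + s by ring]
  -- Since `q / p ≥ 1`, the power is superadditive, so the blocks recombine into the whole tail.
  have h2 : ∑ i ∈ Finset.range K, P i ^ (q / p) ≤ (r : ℝ) ^ (q / p - q / 2) * G ^ (q / 2) := by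
    refine (Real.sum_rpow_le_rpow_sum _ hP0 ((one_le_div hp).2 hpq)).trans ?_
    refine (Real.rpow_le_rpow (Finset.sum_nonneg fun i _ => hP0 i) ?_ (by positivity)).trans
      (sum_range_rpow_le hσ0 hp hp2.le hq r)
    rw [hP, Finset.sum_range_sum_Ico_mul]
    exact htail
  set e := q / p - q / 2 with he
  have he' : e = (2 - p) * q / (2 * p) := by
    rw [he]
    field_simp
  have hepos : 0 < e := by
    rw [he']
    have : 0 < 2 - p := by linarith
    positivity
  -- The exponent of `τ` in the choice of `s` is exactly `1 / e`.
  have h3 : τ * (r : ℝ) ^ e ≤ (s : ℝ) ^ e := by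
    have h4 := Real.rpow_le_rpow (by positivity) hs hepos.le
    rw [Real.mul_rpow hr'.le (by positivity), ← Real.rpow_mul hτ.le] at h4
    have h5 : 2 * p / ((2 - p) * q) * e = 1 := by
      rw [he']
      have : 2 - p ≠ 0 := by linarith
      field_simp
    rw [h5, Real.rpow_one] at h4
    linarith
  have h4 : (s : ℝ) ^ (q / 2 - q / p) = ((s : ℝ) ^ e)⁻¹ := by
    rw [← Real.rpow_neg hs'.le, he, neg_sub]
  rw [h4] at h1
  have hse : 0 < (s : ℝ) ^ e := by positivity
  have hGq : 0 ≤ G ^ (q / 2) := by positivity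
  calc _ ≤ τ * (((s : ℝ) ^ e)⁻¹ * ((r : ℝ) ^ e * G ^ (q / 2))) :=
        mul_le_mul_of_nonneg_left (h1.trans (mul_le_mul_of_nonneg_left h2 (by positivity))) hτ.le
    _ = ((s : ℝ) ^ e)⁻¹ * (τ * (r : ℝ) ^ e) * G ^ (q / 2) := by ring
    _ ≤ ((s : ℝ) ^ e)⁻¹ * (s : ℝ) ^ e * G ^ (q / 2) := by gcongr
    _ = G ^ (q / 2) := by rw [inv_mul_cancel₀ hse.ne', one_mul]

end BlockEstimates

/-! ### Truncated singular value decompositions -/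

section Truncation

/-- The singular value decomposition as a sum of operators of rank one, with the ranks and the
Hilbert-Schmidt norms of its partial sums. -/
theorem LinearMap.exists_sum_rank_one {V F : Type*} [NormedAddCommGroup V]
    [InnerProductSpace ℝ V] [FiniteDimensional ℝ V] [NormedAddCommGroup F] [InnerProductSpace ℝ F]
    [FiniteDimensional ℝ F] (T : V →ₗ[ℝ] F) : ∃ E : ℕ → V →ₗ[ℝ] F,
    (∀ S : Finset ℕ, finrank ℝ (LinearMap.range (∑ i ∈ S, E i)) ≤ S.card) ∧
    (∀ S : Finset ℕ, ∑ k ∈ Finset.range (finrank ℝ V), (∑ i ∈ S, E i).singularValues k ^ 2 =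
      ∑ i ∈ S, T.singularValues i ^ 2) ∧
    ∀ N, finrank ℝ V ≤ N → ∑ i ∈ Finset.range N, E i = T := by
  classical
  obtain ⟨b, hb⟩ := T.exists_orthonormalBasis_norm_eq_singularValues rfl
  let e : ℕ → V := fun i => if h : i < finrank ℝ V then b ⟨i, h⟩ else 0
  have he : ∀ i : Fin (finrank ℝ V), e i = b i := fun i => by simp [e]
  have he0 : ∀ i, finrank ℝ V ≤ i → e i = 0 := fun i hi => by simp [e, hi]
  let E : ℕ → V →ₗ[ℝ] F := fun i => (InnerProductSpace.rankOne ℝ (T (e i)) (e i)).toLinearMap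
  have hE : ∀ i x, E i x = ⟪e i, x⟫_ℝ • T (e i) := fun i x => by simp [E]
  -- A partial sum is `T` restricted to the chosen basis vectors and zero on the others, so its
  -- Hilbert–Schmidt norm can be read off from `b`.
  have hET : ∀ (S : Finset ℕ) (k : Fin (finrank ℝ V)),
      (∑ i ∈ S, E i) (b k) = if (k : ℕ) ∈ S then T (b k) else 0 := by
    intro S k
    rw [LinearMap.sum_apply]
    simp_rw [hE]
    have h1 : ∀ i ∈ S, ⟪e i, b k⟫_ℝ • T (e i) = if (k : ℕ) = i then T (b k) else 0 := by
      intro i _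
      rcases lt_or_ge i (finrank ℝ V) with hi | hi
      · have h2 := he ⟨i, hi⟩
        simp only at h2
        rw [h2, b.inner_eq_ite]
        by_cases hik : (⟨i, hi⟩ : Fin (finrank ℝ V)) = k
        · subst hik
          simp
        · rw [if_neg hik, if_neg (fun h => hik (Fin.ext h.symm)), zero_smul]
      · rw [he0 i hi, if_neg (by have := k.2; omega)]
        simp
    rw [Finset.sum_congr rfl h1, Finset.sum_ite_eq]
  refine ⟨E, fun S => ?_, fun S => ?_, fun N hN => ?_⟩
  · have h1 : LinearMap.range (∑ i ∈ S, E i) ≤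
        Submodule.span ℝ ((S.image fun i => T (e i) : Finset F) : Set F) := by
      rintro _ ⟨x, rfl⟩
      rw [LinearMap.sum_apply]
      refine Submodule.sum_mem _ fun i hi => ?_
      rw [hE]
      exact Submodule.smul_mem _ _ (Submodule.subset_span (by
        simpa using ⟨i, hi, rfl⟩))
    exact (Submodule.finrank_mono h1).trans
      ((finrank_span_finset_le_card _).trans Finset.card_image_le)
  · rw [LinearMap.sum_sq_singularValues _ b]
    simp_rw [hET]
    have h1 : ∀ k : Fin (finrank ℝ V), ‖if (k : ℕ) ∈ S then T (b k) else 0‖ ^ 2 =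
        if (k : ℕ) ∈ S then T.singularValues k ^ 2 else 0 := by
      intro k
      split_ifs
      · rw [hb]
      · simp
    simp_rw [h1]
    rw [← Finset.sum_range (fun k => if k ∈ S then T.singularValues k ^ 2 else 0),
      Finset.sum_ite_mem]
    refine Finset.sum_subset Finset.inter_subset_right fun i hi hi' => ?_
    rw [T.singularValues_of_finrank_le]
    · simp
    · simp only [Finset.mem_inter, Finset.mem_range, hi, and_true] at hi'
      omega
  · refine b.toBasis.ext fun k => ?_
    rw [b.coe_toBasis, hET, if_pos (Finset.mem_range.2 (k.2.trans_le hN))]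

end Truncation

/-! ### Schatten norms and the tail inequality -/

section Schatten

variable {m n : ℕ}

theorem matrixSingularValue_nonneg (X : Matrix (Fin m) (Fin n) ℝ) (j : ℕ) :
    0 ≤ matrixSingularValue X j :=
  LinearMap.singularValues_nonneg _ _

theorem Matrix.rank_eq_finrank_range_toEuclideanLin (X : Matrix (Fin m) (Fin n) ℝ) :
    X.rank = finrank ℝ (LinearMap.range (Matrix.toEuclideanLin X)) := by
  rw [X.rank_eq_finrank_range_toLin (PiLp.basisFun 2 ℝ (Fin m)) (PiLp.basisFun 2 ℝ (Fin n)),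
    ← Matrix.toLpLin_eq_toLin]

theorem matrixSingularValue_eq_zero_iff {X : Matrix (Fin m) (Fin n) ℝ} {j : ℕ} :
    matrixSingularValue X j = 0 ↔ X.rank ≤ j := by
  rw [X.rank_eq_finrank_range_toEuclideanLin]
  exact LinearMap.singularValues_eq_zero_iff_le_finrank_range _

theorem matrixSingularValue_antitone (X : Matrix (Fin m) (Fin n) ℝ) :
    Antitone (matrixSingularValue X) :=
  (Matrix.toEuclideanLin X).singularValues_antitone

theorem matrixSingularValue_zero_pos {X : Matrix (Fin m) (Fin n) ℝ} (hX : X ≠ 0) :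
    0 < matrixSingularValue X 0 := by
  refine (matrixSingularValue_nonneg X 0).lt_of_ne' fun h => hX ?_
  rw [← (Matrix.toEuclideanLin (𝕜 := ℝ) (m := Fin m) (n := Fin n)).map_eq_zero_iff,
    ← LinearMap.singularValues_eq_zero_iff]
  ext j
  exact le_antisymm ((matrixSingularValue_antitone X (Nat.zero_le j)).trans h.le)
    (matrixSingularValue_nonneg X j)

theorem matrixSingularValue_of_min_le (X : Matrix (Fin m) (Fin n) ℝ) {j : ℕ} (hj : min m n ≤ j) :
    matrixSingularValue X j = 0 := by
  have h1 := X.rank_le_height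
  have h2 := X.rank_le_width
  exact matrixSingularValue_eq_zero_iff.2 (by omega)

theorem schattenNorm_rpow {p : ℝ} (hp : p ≠ 0) (X : Matrix (Fin m) (Fin n) ℝ) :
    schattenNorm p X ^ p = ∑ j ∈ Finset.range (min m n), matrixSingularValue X j ^ p := by
  rw [schattenNorm, ← Real.rpow_mul (Finset.sum_nonneg fun j _ =>
    Real.rpow_nonneg (matrixSingularValue_nonneg X j) p), one_div_mul_cancel hp, Real.rpow_one]

/-- Padding with vanishing singular values up to `n`, the dimension of the domain, matches the
Hilbert–Schmidt identity. -/
theorem schattenNorm_two_rpow (q : ℝ) (X : Matrix (Fin m) (Fin n) ℝ) :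
    schattenNorm 2 X ^ q = (∑ j ∈ Finset.range n, matrixSingularValue X j ^ 2) ^ (q / 2) := by
  rw [schattenNorm, ← Real.rpow_mul (Finset.sum_nonneg fun j _ =>
    Real.rpow_nonneg (matrixSingularValue_nonneg X j) 2)]
  congr 1
  · simp only [Real.rpow_two]
    refine Finset.sum_subset (Finset.range_subset_range.2 (min_le_right _ _)) fun j _ hj => ?_
    rw [matrixSingularValue_of_min_le X (not_lt.1 (mt Finset.mem_range.2 hj))]
    simp
  · ring

/-- Mirsky's inequality for the `p`-th powers of the singular values, `0 < p ≤ 1`. -/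
theorem sum_abs_matrixSingularValue_rpow_sub_le {p : ℝ} (hp : 0 < p) (hp1 : p ≤ 1)
    (X Y : Matrix (Fin m) (Fin n) ℝ) :
    ∑ j ∈ Finset.range (min m n), |matrixSingularValue X j ^ p - matrixSingularValue Y j ^ p| ≤
      ∑ j ∈ Finset.range (min m n), matrixSingularValue (X - Y) j ^ p := by
  have h := LinearMap.sum_abs_map_singularValues_sub_le (Real.concaveOn_rpow hp.le hp1)
    (Real.monotoneOn_rpow_Ici_of_exponent_nonneg hp.le) (Real.zero_rpow hp.ne')
    (Matrix.toEuclideanLin X) (Matrix.toEuclideanLin Y)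
  rw [finrank_euclideanSpace_fin, finrank_euclideanSpace_fin, ← map_sub] at h
  exact h

theorem matrixSingularValue_neg (X : Matrix (Fin m) (Fin n) ℝ) (j : ℕ) :
    matrixSingularValue (-X) j = matrixSingularValue X j := by
  rw [matrixSingularValue, map_neg, LinearMap.singularValues_neg, matrixSingularValue]

/-- If adding `H` to a matrix of rank at most `r` does not increase the Schatten `p`-norm, then the
tail of the singular values of `H` is dominated by the first `r` of them. -/
theorem sum_tail_matrixSingularValue_rpow_le {p : ℝ} (hp : 0 < p) (hp1 : p ≤ 1) {r : ℕ}
    {X Z : Matrix (Fin m) (Fin n) ℝ} (hX : X.rank ≤ r)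
    (hZ : schattenNorm p Z ^ p ≤ schattenNorm p X ^ p) (N : ℕ) :
    ∑ j ∈ Finset.Ico r N, matrixSingularValue (Z - X) j ^ p ≤
      ∑ j ∈ Finset.range r, matrixSingularValue (Z - X) j ^ p := by
  set M := max N (max r (min m n))
  have hrM : r ≤ M := by omega
  set h := fun j => matrixSingularValue (Z - X) j ^ p
  have hext : ∀ Y : Matrix (Fin m) (Fin n) ℝ, ∀ j ∈ Finset.range M,
      j ∉ Finset.range (min m n) → matrixSingularValue Y j ^ p = 0 := by
    intro Y j _ hj
    rw [matrixSingularValue_of_min_le Y (not_lt.1 (mt Finset.mem_range.2 hj)), Real.zero_rpow hp.ne']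
  have hsub : Finset.range (min m n) ⊆ Finset.range M := Finset.range_subset_range.2 (by omega)
  -- The sign makes the difference of the two matrices equal to `Z`, whose norm is controlled.
  have h1 := sum_abs_matrixSingularValue_rpow_sub_le hp hp1 X (-(Z - X))
  rw [show X - -(Z - X) = Z by abel] at h1
  simp_rw [matrixSingularValue_neg] at h1
  rw [schattenNorm_rpow hp.ne', schattenNorm_rpow hp.ne'] at hZ
  replace h1 := h1.trans hZ
  rw [Finset.sum_subset hsub (fun j hj hj' => by rw [hext _ j hj hj', hext _ j hj hj']; simp),
    Finset.sum_subset hsub (hext X), ← Finset.sum_range_add_sum_Ico _ hrM,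
    ← Finset.sum_range_add_sum_Ico _ hrM] at h1
  have hx0 : ∀ j ∈ Finset.Ico r M, matrixSingularValue X j ^ p = 0 := fun j hj => by
    rw [matrixSingularValue_eq_zero_iff.2 (hX.trans (Finset.mem_Ico.1 hj).1),
      Real.zero_rpow hp.ne']
  have hh0 : ∀ j, 0 ≤ h j := fun j => Real.rpow_nonneg (matrixSingularValue_nonneg _ j) p
  have h2 : ∑ j ∈ Finset.Ico r M, |matrixSingularValue X j ^ p - matrixSingularValue (Z - X) j ^ p|
      = ∑ j ∈ Finset.Ico r M, h j := by
    refine Finset.sum_congr rfl fun j hj => ?_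
    rw [hx0 j hj, zero_sub, abs_neg, abs_of_nonneg (hh0 j)]
  have h3 : ∑ j ∈ Finset.range r, matrixSingularValue X j ^ p - ∑ j ∈ Finset.range r, h j ≤
      ∑ j ∈ Finset.range r, |matrixSingularValue X j ^ p - matrixSingularValue (Z - X) j ^ p| := by
    rw [← Finset.sum_sub_distrib]
    exact Finset.sum_le_sum fun j _ => le_abs_self _
  rw [h2, Finset.sum_eq_zero hx0] at h1
  have h4 : ∑ j ∈ Finset.Ico r N, h j ≤ ∑ j ∈ Finset.Ico r M, h j :=
    Finset.sum_le_sum_of_subset_of_nonneg (Finset.Ico_subset_Ico le_rfl (by omega))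
      fun j _ _ => hh0 j
  linarith

theorem exists_sum_matrix_rank_one (H : Matrix (Fin m) (Fin n) ℝ) :
    ∃ E : ℕ → Matrix (Fin m) (Fin n) ℝ,
      (∀ S : Finset ℕ, (∑ i ∈ S, E i).rank ≤ S.card) ∧
      (∀ (S : Finset ℕ) (q : ℝ), schattenNorm 2 (∑ i ∈ S, E i) ^ q =
        (∑ i ∈ S, matrixSingularValue H i ^ 2) ^ (q / 2)) ∧
      ∀ N, n ≤ N → ∑ i ∈ Finset.range N, E i = H := by
  obtain ⟨E, h1, h2, h3⟩ := (Matrix.toEuclideanLin H).exists_sum_rank_one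
  have hE : ∀ S : Finset ℕ, Matrix.toEuclideanLin
      (∑ i ∈ S, Matrix.toEuclideanLin.symm (E i)) = ∑ i ∈ S, E i := by
    intro S
    simp
  rw [finrank_euclideanSpace_fin] at h2 h3
  refine ⟨fun i => Matrix.toEuclideanLin.symm (E i), fun S => ?_, fun S q => ?_, fun N hN => ?_⟩
  · rw [Matrix.rank_eq_finrank_range_toEuclideanLin, hE]
    exact h1 S
  · rw [schattenNorm_two_rpow]
    simp only [matrixSingularValue]
    rw [hE, h2]
  · apply Matrix.toEuclideanLin.injective
    rw [hE, h3 N hN]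

end Schatten

/-! ### Kernel argument and exact recovery -/

section Recovery

variable {m n L : ℕ}

theorem vecLqNorm_rpow {q : ℝ} (hq : q ≠ 0) (v : Fin L → ℝ) :
    vecLqNorm q v ^ q = ∑ i, |v i| ^ q := by
  rw [vecLqNorm, ← Real.rpow_mul (Finset.sum_nonneg fun i _ => Real.rpow_nonneg (abs_nonneg _) q),
    one_div_mul_cancel hq, Real.rpow_one]

theorem vecLqNorm_neg (q : ℝ) (v : Fin L → ℝ) : vecLqNorm q (-v) = vecLqNorm q v := by
  simp [vecLqNorm]

theorem vecLqNorm_sum_rpow_le {ι : Type*} (S : Finset ι) (v : ι → Fin L → ℝ) {q : ℝ} (hq : 0 < q)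
    (hq1 : q ≤ 1) : vecLqNorm q (∑ k ∈ S, v k) ^ q ≤ ∑ k ∈ S, vecLqNorm q (v k) ^ q := by
  simp_rw [vecLqNorm_rpow hq.ne']
  rw [Finset.sum_comm]
  refine Finset.sum_le_sum fun i _ => ?_
  rw [Finset.sum_apply]
  exact (Real.rpow_le_rpow (abs_nonneg _) (Finset.abs_sum_le_sum_abs _ _) hq.le).trans
    (Real.rpow_sum_le_sum_rpow S (fun k => abs_nonneg (v k i)) hq hq1)

/-- `ℓ_q`-restricted uniform boundedness also holds at the zero matrix. -/
theorem IsLqRUB.bounds {A : Matrix (Fin m) (Fin n) ℝ →ₗ[ℝ] (Fin L → ℝ)} {q : ℝ} {k : ℕ}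
    {C₁ C₂ : ℝ} (hA : IsLqRUB A q k C₁ C₂) (hq : 0 < q) {X : Matrix (Fin m) (Fin n) ℝ}
    (hX : X.rank ≤ k) : C₁ * schattenNorm 2 X ^ q ≤ vecLqNorm q (A X) ^ q / L ∧
      vecLqNorm q (A X) ^ q / L ≤ C₂ * schattenNorm 2 X ^ q := by
  rcases eq_or_ne X 0 with rfl | h0
  · have h1 : ∀ j, matrixSingularValue (0 : Matrix (Fin m) (Fin n) ℝ) j = 0 := fun j =>
      matrixSingularValue_eq_zero_iff.2 (by simp)
    have h2 : q / 2 ≠ 0 := by positivity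
    rw [schattenNorm_two_rpow, map_zero, vecLqNorm_rpow hq.ne']
    simp [h1, Real.zero_rpow h2, Real.zero_rpow hq.ne']
  · exact hA X h0 hX

/-- A matrix in the kernel of `A` whose singular values beyond the first `r` are dominated in
`ℓ_p` by the first `r` of them is zero. -/
theorem IsLqRUB.eq_zero_of_map_eq_zero {A : Matrix (Fin m) (Fin n) ℝ →ₗ[ℝ] (Fin L → ℝ)}
    {p q τ C₁ C₂ : ℝ} {r s : ℕ} (hA : IsLqRUB A q (s + r) C₁ C₂) (hr : 0 < r) (hp : 0 < p)
    (hpq : p ≤ q) (hq : q ≤ 1) (hτ : 0 < τ) (hs : (r : ℝ) * τ ^ (2 * p / ((2 - p) * q)) ≤ s)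
    (hC : C₂ < τ * C₁) {H : Matrix (Fin m) (Fin n) ℝ} (hH : A H = 0)
    (htail : ∀ N, ∑ j ∈ Finset.Ico r N, matrixSingularValue H j ^ p ≤
      ∑ j ∈ Finset.range r, matrixSingularValue H j ^ p) : H = 0 := by
  by_contra hH0
  have hq0 : 0 < q := hp.trans_le hpq
  have hs' : 0 < s := by
    have : (0 : ℝ) < s := lt_of_lt_of_le (by positivity) hs
    exact_mod_cast this
  obtain ⟨E, hrank, hnorm, hsum⟩ := exists_sum_matrix_rank_one H
  have hb : ∀ S : Finset ℕ, S.card ≤ s + r →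
      C₁ * (∑ i ∈ S, matrixSingularValue H i ^ 2) ^ (q / 2) ≤
          vecLqNorm q (A (∑ i ∈ S, E i)) ^ q / L ∧
        vecLqNorm q (A (∑ i ∈ S, E i)) ^ q / L ≤
          C₂ * (∑ i ∈ S, matrixSingularValue H i ^ 2) ^ (q / 2) := by
    intro S hS
    rw [← hnorm]
    exact hA.bounds hq0 ((hrank S).trans hS)
  set G := (∑ j ∈ Finset.range r, matrixSingularValue H j ^ 2) ^ (q / 2) with hG
  set G' := (∑ j ∈ Finset.range (r + s), matrixSingularValue H j ^ 2) ^ (q / 2) with hG'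
  set B : ℕ → Finset ℕ := fun i => Finset.Ico (r + s + i * s) (r + s + (i + 1) * s) with hB
  have hBcard : ∀ i, (B i).card ≤ s + r := by
    intro i
    rw [hB, Nat.card_Ico]
    have : (i + 1) * s = i * s + s := by ring
    omega
  have hGpos : 0 < G := by
    refine Real.rpow_pos_of_pos ?_ _
    exact Finset.sum_pos' (fun _ _ => sq_nonneg _)
      ⟨0, Finset.mem_range.2 hr, pow_pos (matrixSingularValue_zero_pos hH0) 2⟩
  have hGG' : G ≤ G' := Real.rpow_le_rpow (Finset.sum_nonneg fun _ _ => sq_nonneg _)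
    (Finset.sum_le_sum_of_subset_of_nonneg (Finset.range_subset_range.2 (by omega))
      fun _ _ _ => sq_nonneg _) (by positivity)
  -- Nonnegativity of `C₂` is not assumed: it follows from the upper bound at a truncation of `H`
  -- with positive norm.
  have hC2 : 0 ≤ C₂ := by
    have h1 := (hb (Finset.range r) (by simp)).2
    have h2 : 0 ≤ vecLqNorm q (A (∑ i ∈ Finset.range r, E i)) ^ q / L := by
      rw [vecLqNorm_rpow hq0.ne']
      exact div_nonneg (Finset.sum_nonneg fun i _ => Real.rpow_nonneg (abs_nonneg _) q)
        (Nat.cast_nonneg L)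
    exact nonneg_of_mul_nonneg_left (h2.trans h1) hGpos
  -- As `s ≥ 1`, `n` blocks reach past index `n`, so head and blocks sum to `H`.
  have hsplit : A (∑ i ∈ Finset.range (r + s), E i) =
      -∑ k ∈ Finset.range n, A (∑ i ∈ B k, E i) := by
    rw [eq_neg_iff_add_eq_zero, ← map_sum, ← map_add, hB, Finset.sum_range_sum_Ico_mul,
      Finset.sum_range_add_sum_Ico _ (by omega), hsum _ (by nlinarith), hH]
  have h1 : vecLqNorm q (A (∑ i ∈ Finset.range (r + s), E i)) ^ q / L ≤
      ∑ k ∈ Finset.range n, vecLqNorm q (A (∑ i ∈ B k, E i)) ^ q / L := by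
    rw [hsplit, vecLqNorm_neg, ← Finset.sum_div]
    exact div_le_div_of_nonneg_right (vecLqNorm_sum_rpow_le _ _ hq0 hq) (Nat.cast_nonneg L)
  have h2 : C₁ * G' ≤ C₂ * ∑ k ∈ Finset.range n,
      (∑ j ∈ B k, matrixSingularValue H j ^ 2) ^ (q / 2) := by
    refine (hb (Finset.range (r + s)) (by simp [add_comm])).1.trans (h1.trans ?_)
    rw [Finset.mul_sum]
    exact Finset.sum_le_sum fun k _ => (hb (B k) (hBcard k)).2
  have h3 := sum_sum_sq_rpow_le (matrixSingularValue_antitone H) (matrixSingularValue_nonneg H) hp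
    hpq (by linarith) hτ hr hs n (htail _)
  have h4 : τ * C₁ * G' ≤ C₂ * G' := by
    calc τ * C₁ * G' = τ * (C₁ * G') := by ring
      _ ≤ τ * (C₂ * ∑ k ∈ Finset.range n,
          (∑ j ∈ B k, matrixSingularValue H j ^ 2) ^ (q / 2)) :=
        mul_le_mul_of_nonneg_left h2 hτ.le
      _ = C₂ * (τ * ∑ k ∈ Finset.range n,
          (∑ j ∈ B k, matrixSingularValue H j ^ 2) ^ (q / 2)) := by ring
      _ ≤ C₂ * G' := mul_le_mul_of_nonneg_left (h3.trans hGG') hC2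
  exact absurd (le_of_mul_le_mul_right h4 (hGpos.trans_le hGG')) (not_le.2 hC)

end Recovery

theorem mainTheorem7 {m n L : ℕ} (A : Matrix (Fin m) (Fin n) ℝ →ₗ[ℝ] (Fin L → ℝ))
    (r : ℕ) (hr : 0 < r) (p q : ℝ) (hp : 0 < p) (hpq : p ≤ q) (hq : q ≤ 1)
    (τ : ℝ) (hτ : 1 < τ) (s : ℕ) (hs : s = ⌈(r : ℝ) * τ ^ (2 * p / ((2 - p) * q))⌉₊)
    (δlb δsub : ℝ) (hA : IsRIPL2Lq A q (s + r) δlb δsub)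
    (hδ : δsub + τ * δlb < τ - 1) :
    ∀ X : Matrix (Fin m) (Fin n) ℝ, X.rank ≤ r →
      ∀ Z : Matrix (Fin m) (Fin n) ℝ, IsSchattenMinimizer A p (A X) {0} Z ↔ Z = X := by
  intro X hX
  -- A feasible matrix no worse than `X` is `X` itself; this yields both uniqueness and the
  -- optimality of `X`.
  have key : ∀ Z, A X - A Z ∈ ({0} : Set (Fin L → ℝ)) →
      schattenNorm p Z ^ p ≤ schattenNorm p X ^ p → Z = X := by
    intro Z hAZ hZ
    have hAZ' : A (Z - X) = 0 := by
      rw [map_sub, ← neg_sub, Set.mem_singleton_iff.1 hAZ, neg_zero]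
    have hs' : (r : ℝ) * τ ^ (2 * p / ((2 - p) * q)) ≤ s := hs ▸ Nat.le_ceil _
    -- The hypothesis on the constants rearranges to `1 + δsub < τ * (1 - δlb)`.
    exact sub_eq_zero.1 (IsLqRUB.eq_zero_of_map_eq_zero hA hr hp hpq hq (by linarith) hs'
      (by linarith) hAZ' (sum_tail_matrixSingularValue_rpow_le hp (hpq.trans hq) hX hZ))
  have hXX : A X - A X ∈ ({0} : Set (Fin L → ℝ)) := by simp
  intro Z
  constructor
  · rintro ⟨hAZ, hZ⟩
    exact key Z hAZ (hZ X hXX)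
  · rintro rfl
    refine ⟨hXX, fun W hW => ?_⟩
    rcases le_total (schattenNorm p Z ^ p) (schattenNorm p W ^ p) with h | h
    · exact h
    · rw [key W hW h]
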